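/- For a nonnegative integer $n$, let $a_e(n)$ (respectively $a_o(n)$) be the number of partitions of $n$ into an even (respectively odd) number of parts in which the even parts can appear in two colours, and let $A(n)=a_e(n)-a_o(n)$. Then for all integers $j\ge 0$ and $n\ge 0$, \begin{align*} A(3n+1) &\equiv A(27n+8) \pmod 3,\\ A\left(9^{j+1}n+\frac{39\cdot 9^{j}+1}{8}\right) &\equiv 0 \pmod 3,\\ A\left(3\cdot 9^{j+1}n+\frac{23\cdot 9^{j+1}+1}{8}\right) &\equiv 0 \pmod 3. \end{align*} -/

import Mathlib

/-- A cubic partition of `n`: a finite multiset of coloured parts `(size, colour)` whose sizes are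
positive and add up to `n`. There are two colours, `false` and `true`; the odd parts only come in
the colour `false`, while the even parts may appear in either colour. The order of the parts is
irrelevant, but parts of the same size and of different colours are different. -/
@[ext]
structure CubicPartition (n : ℕ) where
  /-- The coloured parts, with multiplicity. -/
  parts : Multiset (ℕ × Bool)
  size_pos : ∀ x ∈ parts, 0 < x.1
  odd_colour : ∀ x ∈ parts, Odd x.1 → x.2 = false
  size_sum : (parts.map Prod.fst).sum = n

namespace CubicPartition

/-- The number of parts of a cubic partition. -/
def numParts {n : ℕ} (p : CubicPartition n) : ℕ := Multiset.card p.parts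

/-- There are only finitely many cubic partitions of `n`, so that counting them with `Nat.card`
gives their actual number. -/
instance finite (n : ℕ) : Finite (CubicPartition n) := by
  classical
  let S : Finset (ℕ × Bool) := Finset.range (n + 1) ×ˢ Finset.univ
  have hmem : ∀ p : CubicPartition n, p.parts ∈ {s | s ∈ Multiset.powerset (n • S.val)} := by
    intro p
    have hcard : Multiset.card p.parts ≤ n := by
      have h := Multiset.card_nsmul_le_sum (s := p.parts.map Prod.fst) (a := 1) (by
        intro x hx
        obtain ⟨y, hy, rfl⟩ := Multiset.mem_map.1 hx
        exact p.size_pos y hy)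
      rw [p.size_sum] at h
      simpa using h
    rw [Set.mem_ofPred_eq, Multiset.mem_powerset, Multiset.le_iff_count]
    intro a
    by_cases ha : a ∈ p.parts
    · have hle : a.1 ≤ n := by
        rw [← p.size_sum]
        exact Multiset.single_le_sum (by simp) _ (Multiset.mem_map_of_mem _ ha)
      have haS : a ∈ S := by
        simp only [S, Finset.mem_product, Finset.mem_range, Finset.mem_univ, and_true]
        omega
      have h1 : Multiset.count a S.val = 1 :=
        Multiset.count_eq_one_of_mem S.nodup haS
      rw [Multiset.count_nsmul, h1, mul_one]
      exact (Multiset.count_le_card a p.parts).trans hcard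
    · rw [Multiset.count_eq_zero_of_notMem ha]
      exact Nat.zero_le _
  have hfin : {s | s ∈ Multiset.powerset (n • S.val)}.Finite :=
    (Multiset.powerset (n • S.val)).finite_toSet
  have := hfin.to_subtype
  exact Finite.of_injective
    (fun p : CubicPartition n =>
      (⟨p.parts, hmem p⟩ : {s | s ∈ Multiset.powerset (n • S.val)}))
    (fun p q h => CubicPartition.ext (congrArg Subtype.val h))

end CubicPartition

/-- `a_e(n)`: the number of cubic partitions of `n` into an even number of parts. -/
noncomputable def cubicEven (n : ℕ) : ℕ :=
  Nat.card {p : CubicPartition n // Even p.numParts}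

/-- `a_o(n)`: the number of cubic partitions of `n` into an odd number of parts. -/
noncomputable def cubicOdd (n : ℕ) : ℕ :=
  Nat.card {p : CubicPartition n // Odd p.numParts}

/-- `A(n) = a_e(n) - a_o(n)`, an integer that may be negative. -/
noncomputable def cubicDiff (n : ℕ) : ℤ := (cubicEven n : ℤ) - (cubicOdd n : ℤ)

/-!
The generating function of `cubicDiff` is `∏ 1 / ((1 + q^k) (1 + q^(2k)))`, and Gauss's product
formulas for the theta series `φ(-q) = ∑ (-1)^w q^(w²)` and `ψ(-q) = ∑ (-1)^m q^(2m²+m)` turn it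
into `φ(-q) / ψ(-q)` (`cubicSeries_mul_thetaPsi`). The product formulas follow from finite
identities proved by telescoping (`prod_mul_sum_neg_one_pow_sq`, `prod_mul_sum_triangular`).

Modulo `3` the cube of a series in `q` is the same series in `q³`, so the generating function is
`φ(-q) ψ(-q)² / ψ(-q³)`. Sorting the terms of both theta series by residues modulo `3` gives
`φ(-q) ≡ φ(-q⁹) + q Ω(q³)` and `ψ(-q) = Π(q³) - q ψ(-q⁹)`. In the numerator the parts with exponents
`1` and `2` modulo `3` are then `Π(q) S(q)` and `ψ(-q³) S(q)` after `q³ ↦ q`, where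
`S(q) = φ(-q³) ψ(-q³) + Ω(q) Π(q)`. Multiplication by `1 + √-2`, of norm `3`, on the form `x² + 2y²`
shows that `S(q) = 2 ψ(-q) ψ(q²)` (`thetaPsi_mul_thetaDelta`), and the denominator cancels: modulo
`3`, the numbers `cubicDiff (3n + 1)` are the coefficients of `2 Π(q) ψ(q²)`, and
`cubicDiff (3n + 2)` those of `2 ψ(-q³) ψ(q²)`.

Since `j² + j` is never `1` modulo `3`, the latter series yields `cubicDiff (9n + 5) ≡ 0`, and
`cubicDiff (9n + 8)` is given by `2 ψ(-q) ψ(q⁶)`. Dissecting `ψ(-q)` once more gives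
`cubicDiff (27n + 8) ≡ cubicDiff (3n + 1)`, `cubicDiff (27n + 17) ≡ -cubicDiff (3n + 2)` and
`cubicDiff (27n + 26) ≡ 0`. The second of these is the induction step `N ↦ 9N - 1` for both families
of congruences.
-/

open PowerSeries


/-! ### Series attached to a family of exponents -/

/-- The formal sum `∑ i, s i * q ^ e i` over an index type with finitely many exponents below every
bound. Exponents are integers so that they can be rewritten by ring identities; a negative exponent
contributes nothing, and infinite fibres of `e` are given the junk value of `finsum`. -/
noncomputable def expSeries {ι R : Type*} [CommRing R] (e : ι → ℤ) (s : ι → R) : R⟦X⟧ :=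
  PowerSeries.mk fun n => ∑ᶠ i, if e i = n then s i else 0

/-- Nonnegative exponents of which only finitely many lie below any bound. -/
structure ProperExponents {ι : Type*} (e : ι → ℤ) : Prop where
  nonneg : ∀ i, 0 ≤ e i
  finite : ∀ n : ℤ, {i | e i ≤ n}.Finite

theorem ProperExponents.of_abs_le {e : ℤ → ℤ} (h : ∀ m, |m| ≤ e m + 1) (h0 : ∀ m, 0 ≤ e m) :
    ProperExponents e :=
  ⟨h0, fun n => (Set.finite_Icc (-(n + 1)) (n + 1)).subset fun m hm => by
    have := h m
    rw [Set.mem_ofPred_eq] at hm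
    exact abs_le.1 (by linarith)⟩

section ExpSeries

variable {ι κ R : Type*} [CommRing R]

theorem coeff_expSeries (e : ι → ℤ) (s : ι → R) (n : ℕ) :
    coeff n (expSeries e s) = ∑ᶠ i, if e i = n then s i else 0 := by
  simp [expSeries]

theorem expSeries_comp_equiv (σ : κ ≃ ι) (e : ι → ℤ) (s : ι → R) :
    expSeries (fun k => e (σ k)) (fun k => s (σ k)) = expSeries e s := by
  ext n
  simp only [coeff_expSeries]
  exact finsum_comp_equiv σ (f := fun i => if e i = n then s i else 0)

theorem expSeries_neg (e : ι → ℤ) (s : ι → R) :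
    expSeries e (fun i => -s i) = -expSeries e s := by
  ext n
  simp only [coeff_expSeries, map_neg, ← finsum_neg_distrib]
  refine finsum_congr fun i => ?_
  split_ifs <;> simp

theorem expSeries_mul_exponent {p : ℕ} (hp : p ≠ 0) (e : ι → ℤ) (s : ι → R) :
    expSeries (fun i => p * e i) s = expand p hp (expSeries e s) := by
  ext n
  simp only [coeff_expSeries, coeff_expand]
  split_ifs with h
  · obtain ⟨m, rfl⟩ := h
    simp [Nat.mul_div_cancel_left m (Nat.pos_of_ne_zero hp), hp]
  · refine (finsum_congr fun i => if_neg fun hi => h ?_).trans finsum_zero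
    exact_mod_cast Dvd.intro _ hi

theorem expSeries_add_exponent (k : ℕ) {e : ι → ℤ} (he : ∀ i, 0 ≤ e i) (s : ι → R) :
    expSeries (fun i => e i + k) s = X ^ k * expSeries e s := by
  ext n
  simp only [coeff_expSeries, coeff_X_pow_mul']
  split_ifs with h
  · refine finsum_congr fun i => ?_
    congr 1
    rw [eq_iff_iff]
    omega
  · refine (finsum_congr fun i => if_neg fun hi => h ?_).trans finsum_zero
    have := he i
    omega

/-- A truncation that contains all terms of degree at most `n` agrees with the series up to
degree `n`. -/
theorem X_pow_dvd_expSeries_sub_sum {e : ι → ℤ} (he : ∀ i, 0 ≤ e i) (s : ι → R) (F : Finset ι)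
    (n : ℕ) (hF : ∀ i, e i ≤ n → i ∈ F) :
    X ^ (n + 1) ∣ expSeries e s - ∑ i ∈ F, C (s i) * X ^ (e i).toNat := by
  rw [X_pow_dvd_iff]
  intro m hm
  rw [map_sub, coeff_expSeries, map_sum, finsum_eq_sum_of_support_subset (s := F), sub_eq_zero]
  · refine Finset.sum_congr rfl fun i _ => ?_
    rw [coeff_C_mul, coeff_X_pow, mul_ite, mul_one, mul_zero]
    congr 1
    rw [eq_iff_iff]
    have := he i
    omega
  · intro i hi
    refine hF i ?_
    by_contra hlt
    refine hi (if_neg ?_)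
    omega

theorem eq_of_forall_X_pow_dvd_sub {f g : R⟦X⟧} (h : ∀ n, X ^ (n + 1) ∣ f - g) : f = g := by
  ext n
  have := X_pow_dvd_iff.1 (h n) n n.lt_succ_self
  rwa [map_sub, sub_eq_zero] at this

theorem ProperExponents.add {e : ι → ℤ} {e' : κ → ℤ} (he : ProperExponents e)
    (he' : ProperExponents e') : ProperExponents fun p : ι × κ => e p.1 + e' p.2 :=
  ⟨fun p => add_nonneg (he.nonneg _) (he'.nonneg _), fun n =>
    ((he.finite n).prod (he'.finite n)).subset fun p hp => by
      have h1 := he.nonneg p.1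
      have h2 := he'.nonneg p.2
      simp only [Set.mem_ofPred_eq, Set.mem_prod] at hp ⊢
      omega⟩

theorem expSeries_mul {e : ι → ℤ} {e' : κ → ℤ} (he : ProperExponents e)
    (he' : ProperExponents e') (s : ι → R) (s' : κ → R) :
    expSeries e s * expSeries e' s' =
      expSeries (fun p : ι × κ => e p.1 + e' p.2) (fun p => s p.1 * s' p.2) := by
  refine eq_of_forall_X_pow_dvd_sub fun n => ?_
  obtain ⟨a, ha⟩ := X_pow_dvd_expSeries_sub_sum he.nonneg s (he.finite n).toFinset n (by simp)
  obtain ⟨b, hb⟩ := X_pow_dvd_expSeries_sub_sum he'.nonneg s' (he'.finite n).toFinset n (by simp)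
  obtain ⟨c, hc⟩ := X_pow_dvd_expSeries_sub_sum (he.add he').nonneg (fun p => s p.1 * s' p.2)
    ((he.finite n).toFinset ×ˢ (he'.finite n).toFinset) n (by
      intro p hp
      have h1 := he.nonneg p.1
      have h2 := he'.nonneg p.2
      simp only [Finset.mem_product, Set.Finite.mem_toFinset, Set.mem_ofPred_eq]
      omega)
  have hprod : ∑ p ∈ (he.finite n).toFinset ×ˢ (he'.finite n).toFinset,
      C (s p.1 * s' p.2) * (X : R⟦X⟧) ^ (e p.1 + e' p.2).toNat =
      (∑ i ∈ (he.finite n).toFinset, C (s i) * X ^ (e i).toNat) *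
        ∑ j ∈ (he'.finite n).toFinset, C (s' j) * X ^ (e' j).toNat := by
    rw [Finset.sum_mul_sum, Finset.sum_product]
    refine Finset.sum_congr rfl fun i _ => Finset.sum_congr rfl fun j _ => ?_
    rw [Int.toNat_add (he.nonneg i) (he'.nonneg j), pow_add, map_mul]
    ring
  rw [hprod] at hc
  refine ⟨a * expSeries e' s' + (∑ i ∈ (he.finite n).toFinset, C (s i) * X ^ (e i).toNat) * b - c,
    ?_⟩
  linear_combination expSeries e' s' * ha +
    (∑ i ∈ (he.finite n).toFinset, C (s i) * X ^ (e i).toNat) * hb - hc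

/-- Splitting an exponent series into three subfamilies. -/
theorem expSeries_eq_add_add {e : ι → ℤ} (he : ProperExponents e) (s : ι → R)
    (σ : κ × Fin 3 ≃ ι) :
    expSeries e s = expSeries (fun k => e (σ (k, 0))) (fun k => s (σ (k, 0))) +
      expSeries (fun k => e (σ (k, 1))) (fun k => s (σ (k, 1))) +
      expSeries (fun k => e (σ (k, 2))) (fun k => s (σ (k, 2))) := by
  ext n
  simp only [coeff_expSeries, map_add]
  let τ := (Equiv.prodComm (Fin 3) κ).trans σ
  rw [← finsum_comp_equiv τ (f := fun i => if e i = n then s i else 0), finsum_curry,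
    finsum_eq_sum_of_fintype, Fin.sum_univ_three]
  · rfl
  · refine ((he.finite n).preimage τ.injective.injOn).subset fun i hi => ?_
    by_contra hlt
    exact hi (if_neg fun h => hlt h.le)

end ExpSeries

/-! ### Theta series and their dissections modulo 3 -/

/-- The sign `(-1) ^ m` for an integer `m`, as an element of `R`. -/
def intSign (R : Type*) [CommRing R] (m : ℤ) : R := ((-1 : Rˣ) ^ m : Rˣ)

section Theta

variable {R : Type*} [CommRing R]

theorem intSign_add (a b : ℤ) : intSign R (a + b) = intSign R a * intSign R b := by
  simp [intSign, zpow_add]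

theorem intSign_two_mul (a : ℤ) : intSign R (2 * a) = 1 := by
  simp [intSign, zpow_mul]

theorem intSign_add_two_mul (a b : ℤ) : intSign R (a + 2 * b) = intSign R a := by
  rw [intSign_add, intSign_two_mul, mul_one]

theorem intSign_add_one (a : ℤ) : intSign R (a + 1) = -intSign R a := by
  rw [intSign_add]; simp [intSign]

theorem intSign_congr {a b : ℤ} (c : ℤ) (h : a = b + 2 * c) : intSign R a = intSign R b := by
  rw [h, intSign_add_two_mul]

theorem intSign_congr_neg {a b : ℤ} (c : ℤ) (h : a = b + 1 + 2 * c) :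
    intSign R a = -intSign R b := by
  rw [h, intSign_add_two_mul, intSign_add_one]

variable (R)

/-- `φ(-q) = ∑ (-1)^w q^(w²)`. -/
noncomputable def thetaPhi : R⟦X⟧ := expSeries (fun w : ℤ => w ^ 2) (intSign R)

/-- `ψ(-q) = ∑ (-1)^m q^(2m²+m)`, the sum over all integers `m`. -/
noncomputable def thetaPsi : R⟦X⟧ := expSeries (fun m : ℤ => 2 * m ^ 2 + m) (intSign R)

/-- `2ψ(q²) = ∑ q^(j²+j)`, the sum over all integers `j`. -/
noncomputable def thetaDelta : R⟦X⟧ := expSeries (fun j : ℤ => j ^ 2 + j) (fun _ => (1 : R))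

/-- The part of `φ(-q)` supported on exponents `1` modulo `3` is `-2q Ω(q³)` for this series `Ω`. -/
noncomputable def thetaOmega : R⟦X⟧ := expSeries (fun w : ℤ => 3 * w ^ 2 + 2 * w) (intSign R)

/-- The terms of `ψ(-q)` with `m ≡ 0` modulo `3`, after `q³ ↦ q`. -/
noncomputable def thetaPiZero : R⟦X⟧ := expSeries (fun k : ℤ => 6 * k ^ 2 + k) (intSign R)

/-- Minus the terms of `ψ(-q)` with `m ≡ 1` modulo `3`, after `q³ ↦ q`. -/
noncomputable def thetaPiOne : R⟦X⟧ := expSeries (fun k : ℤ => 6 * k ^ 2 + 5 * k + 1) (intSign R)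

/-- The part of `2ψ(q²)` supported on exponents divisible by `3`, after `q³ ↦ q`. -/
noncomputable def thetaEta : R⟦X⟧ :=
  expSeries (fun k : ℤ => 3 * k ^ 2 + k) (fun _ => (1 : R)) +
    expSeries (fun k : ℤ => 3 * k ^ 2 + 5 * k + 2) (fun _ => (1 : R))

variable {R}

theorem proper_phi : ProperExponents fun w : ℤ => w ^ 2 :=
  .of_abs_le (fun m => by nlinarith [sq_abs m, sq_nonneg (|m| - 1)]) fun m => by positivity

theorem proper_psi : ProperExponents fun m : ℤ => 2 * m ^ 2 + m :=
  .of_abs_le (fun m => abs_le.2 ⟨by nlinarith, by nlinarith⟩) fun m => by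
    nlinarith [Int.le_self_sq (-m)]

theorem proper_delta : ProperExponents fun j : ℤ => j ^ 2 + j :=
  .of_abs_le (fun m => abs_le.2 ⟨by nlinarith, by nlinarith⟩) fun m => by
    nlinarith [Int.le_self_sq (-m)]

theorem proper_omega : ProperExponents fun w : ℤ => 3 * w ^ 2 + 2 * w :=
  .of_abs_le (fun m => abs_le.2 ⟨by nlinarith, by nlinarith⟩) fun m => by
    nlinarith [Int.le_self_sq (-m)]

theorem proper_piZero : ProperExponents fun k : ℤ => 6 * k ^ 2 + k :=
  .of_abs_le (fun m => abs_le.2 ⟨by nlinarith, by nlinarith⟩) fun m => by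
    nlinarith [Int.le_self_sq (-m)]

theorem proper_piOne : ProperExponents fun k : ℤ => 6 * k ^ 2 + 5 * k + 1 :=
  .of_abs_le (fun m => abs_le.2 ⟨by nlinarith, by nlinarith⟩) fun m => by
    nlinarith [Int.le_self_sq (-m)]

/-- Writing an integer as `3k`, `3k + 1` or `3k + 2`. -/
def intThree : ℤ × Fin 3 ≃ ℤ := (Int.divModEquiv 3).symm

theorem intThree_apply (k : ℤ) (r : Fin 3) : intThree (k, r) = 3 * k + (r : ℕ) := by
  simp [intThree, Int.divModEquiv, mul_comm]

/-- The reflection `k ↦ -k - 1`. -/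
def intReflect : ℤ ≃ ℤ := (Equiv.neg ℤ).trans (Equiv.subRight (1 : ℤ))

theorem intReflect_apply (k : ℤ) : intReflect k = -k - 1 := rfl

theorem expSeries_congr {ι : Type*} {e e' : ι → ℤ} {s s' : ι → R} (he : ∀ i, e i = e' i)
    (hs : ∀ i, s i = s' i) : expSeries e s = expSeries e' s' := by
  rw [funext he, funext hs]

theorem thetaPhi_dissection : thetaPhi R =
    expand 3 three_ne_zero (expand 3 three_ne_zero (thetaPhi R)) -
      2 * (X * expand 3 three_ne_zero (thetaOmega R)) := by
  have h0 : expSeries (fun k => intThree (k, 0) ^ 2) (fun k => intSign R (intThree (k, 0))) =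
      expand 3 three_ne_zero (expand 3 three_ne_zero (thetaPhi R)) := by
    rw [thetaPhi, ← expSeries_mul_exponent, ← expSeries_mul_exponent]
    refine expSeries_congr (fun k => ?_) fun k => intSign_congr k ?_ <;>
      simp only [intThree_apply] <;> push_cast [Fin.val_zero] <;> ring
  have h1 : expSeries (fun k => intThree (k, 1) ^ 2) (fun k => intSign R (intThree (k, 1))) =
      -(X * expand 3 three_ne_zero (thetaOmega R)) := by
    rw [thetaOmega, ← expSeries_mul_exponent, ← pow_one X, ← expSeries_add_exponent,
      ← expSeries_neg]
    · refine expSeries_congr (fun k => ?_) fun k => intSign_congr_neg k ?_ <;>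
        simp only [intThree_apply] <;> push_cast [Fin.val_one] <;> ring
    · exact fun k => mul_nonneg (by norm_num) (proper_omega.nonneg k)
  have h2 : expSeries (fun k => intThree (k, 2) ^ 2) (fun k => intSign R (intThree (k, 2))) =
      -(X * expand 3 three_ne_zero (thetaOmega R)) := by
    rw [← h1, ← expSeries_comp_equiv intReflect]
    refine expSeries_congr (fun k => ?_) fun k => intSign_congr (-3 * k - 1) ?_ <;>
      simp only [intThree_apply, intReflect_apply] <;> push_cast [Fin.val_one, Fin.val_two] <;> ring
  conv_lhs => rw [thetaPhi, expSeries_eq_add_add proper_phi _ intThree, h0, h1, h2]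
  ring

theorem thetaPsi_dissection : thetaPsi R =
    expand 3 three_ne_zero (thetaPiZero R - thetaPiOne R) -
      X * expand 3 three_ne_zero (expand 3 three_ne_zero (thetaPsi R)) := by
  have h0 : expSeries (fun k => 2 * intThree (k, 0) ^ 2 + intThree (k, 0))
      (fun k => intSign R (intThree (k, 0))) = expand 3 three_ne_zero (thetaPiZero R) := by
    rw [thetaPiZero, ← expSeries_mul_exponent]
    refine expSeries_congr (fun k => ?_) fun k => intSign_congr k ?_ <;>
      simp only [intThree_apply] <;> push_cast [Fin.val_zero] <;> ring
  have h1 : expSeries (fun k => 2 * intThree (k, 1) ^ 2 + intThree (k, 1))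
      (fun k => intSign R (intThree (k, 1))) = -expand 3 three_ne_zero (thetaPiOne R) := by
    rw [thetaPiOne, ← expSeries_mul_exponent, ← expSeries_neg]
    refine expSeries_congr (fun k => ?_) fun k => intSign_congr_neg k ?_ <;>
      simp only [intThree_apply] <;> push_cast [Fin.val_one] <;> ring
  have h2 : expSeries (fun k => 2 * intThree (k, 2) ^ 2 + intThree (k, 2))
      (fun k => intSign R (intThree (k, 2))) =
      -(X * expand 3 three_ne_zero (expand 3 three_ne_zero (thetaPsi R))) := by
    rw [thetaPsi, ← expSeries_mul_exponent, ← expSeries_mul_exponent, ← pow_one X,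
      ← expSeries_add_exponent, ← expSeries_neg, ← expSeries_comp_equiv intReflect]
    · refine expSeries_congr (fun k => ?_) fun k => intSign_congr_neg (-2 * k - 1) ?_ <;>
        simp only [intThree_apply, intReflect_apply] <;> push_cast [Fin.val_two] <;> ring
    · exact fun k => mul_nonneg (by norm_num) (mul_nonneg (by norm_num) (proper_psi.nonneg k))
  conv_lhs => rw [thetaPsi, expSeries_eq_add_add proper_psi _ intThree, h0, h1, h2]
  rw [map_sub]
  ring

theorem thetaDelta_dissection : thetaDelta R =
    expand 3 three_ne_zero (thetaEta R) +
      X ^ 2 * expand 3 three_ne_zero (expand 3 three_ne_zero (thetaDelta R)) := by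
  conv_lhs => rw [thetaDelta, expSeries_eq_add_add proper_delta _ intThree]
  rw [thetaEta, thetaDelta, map_add, ← expSeries_mul_exponent, ← expSeries_mul_exponent,
    ← expSeries_mul_exponent, ← expSeries_mul_exponent, ← expSeries_add_exponent, add_right_comm]
  · congr 1
    · congr 1 <;> refine expSeries_congr (fun k => ?_) fun k => rfl <;>
        simp only [intThree_apply] <;> push_cast [Fin.val_zero, Fin.val_two] <;> ring
    · refine expSeries_congr (fun k => ?_) fun k => rfl
      simp only [intThree_apply]
      push_cast [Fin.val_one]
      ring
  · exact fun k => mul_nonneg (by norm_num) (mul_nonneg (by norm_num) (proper_delta.nonneg k))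

/-- `((i, k), r) ↦ (i, i + 3k + r)`. -/
def latticeThree : (ℤ × ℤ) × Fin 3 ≃ ℤ × ℤ :=
  ((Equiv.prodAssoc ℤ ℤ (Fin 3)).trans ((Equiv.refl ℤ).prodCongr intThree)).trans
    (Equiv.prodShear (Equiv.refl ℤ) Equiv.addLeft)

theorem latticeThree_apply (i k : ℤ) (r : Fin 3) :
    latticeThree ((i, k), r) = (i, i + (3 * k + (r : ℕ))) := by
  simp [latticeThree, intThree_apply, Equiv.prodShear]

/-- The affine shear `(i, k) ↦ (i + k + c, k)`. -/
def shear (c : ℤ) : ℤ × ℤ ≃ ℤ × ℤ where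
  toFun p := (p.1 + p.2 + c, p.2)
  invFun p := (p.1 - p.2 - c, p.2)
  left_inv p := Prod.ext (by dsimp only; ring) rfl
  right_inv p := Prod.ext (by dsimp only; ring) rfl

/-- Multiplication by the element `1 + √-2` of norm `3` in `ℤ[√-2]`. With `x = 4i + 1` and
`y = 2j + 1`, the left-hand side enumerates `(x² + 2y² - 3) / 8`. The product with `1 + √-2` is
`X + Y√-2` for `X = x - 2y` and `Y = x + y`, with `X² + 2Y² = 3 (x² + 2y²)` and `X ≡ Y` modulo `3`.
The pairs with both `X` and `Y` divisible by `3` give the first product on the right, and the other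
two residue classes give the second one. -/
theorem thetaPsi_mul_thetaDelta : thetaPsi R * thetaDelta R =
    expand 3 three_ne_zero (thetaPhi R) * expand 3 three_ne_zero (thetaPsi R) +
      thetaOmega R * (thetaPiZero R - thetaPiOne R) := by
  have hOmega : thetaOmega R = expSeries (fun w : ℤ => 3 * w ^ 2 - 2 * w) (intSign R) := by
    rw [thetaOmega, ← expSeries_comp_equiv (Equiv.neg ℤ)]
    refine expSeries_congr (fun k => ?_) fun k => intSign_congr (-k) ?_ <;>
      simp only [Equiv.neg_apply] <;> ring
  have hproper : ProperExponents fun w : ℤ => 3 * w ^ 2 - 2 * w :=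
    .of_abs_le (fun m => abs_le.2 ⟨by nlinarith, by nlinarith⟩) fun m => by
      nlinarith [Int.le_self_sq m]
  have hphi3 : ProperExponents fun w : ℤ => ((3 : ℕ) : ℤ) * w ^ 2 :=
    .of_abs_le (fun m => by push_cast; nlinarith [sq_abs m, sq_nonneg (|m| - 1)])
      fun m => by positivity
  have hpsi3 : ProperExponents fun m : ℤ => ((3 : ℕ) : ℤ) * (2 * m ^ 2 + m) :=
    .of_abs_le (fun m => abs_le.2 ⟨by push_cast; nlinarith, by push_cast; nlinarith⟩) fun m => by
      push_cast; nlinarith [Int.le_self_sq (-m)]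
  let e : ℤ × ℤ → ℤ := fun p => 2 * p.1 ^ 2 + p.1 + (p.2 ^ 2 + p.2)
  let s : ℤ × ℤ → R := fun p => intSign R p.1 * 1
  have h0 : expSeries (fun p => e (latticeThree (p, 0))) (fun p => s (latticeThree (p, 0))) =
      thetaOmega R * thetaPiZero R := by
    rw [thetaOmega, thetaPiZero, expSeries_mul proper_omega proper_piZero]
    refine Eq.trans ?_ (expSeries_comp_equiv (shear 0) _ _)
    refine expSeries_congr (fun ⟨i, k⟩ => ?_) fun ⟨i, k⟩ => ?_
    · simp only [latticeThree_apply, shear, Equiv.coe_fn_mk, e]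
      push_cast [Fin.val_zero]
      ring
    · simp only [latticeThree_apply, shear, Equiv.coe_fn_mk, s, mul_one, ← intSign_add]
      exact intSign_congr (-k) (by ring)
  have h1 : expSeries (fun p => e (latticeThree (p, 1))) (fun p => s (latticeThree (p, 1))) =
      -(thetaOmega R * thetaPiOne R) := by
    rw [hOmega, thetaPiOne, expSeries_mul hproper proper_piOne,
      ← expSeries_neg]
    refine Eq.trans ?_ (expSeries_comp_equiv (shear 1) _ _)
    refine expSeries_congr (fun ⟨i, k⟩ => ?_) fun ⟨i, k⟩ => ?_
    · simp only [latticeThree_apply, shear, Equiv.coe_fn_mk, e]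
      push_cast [Fin.val_one]
      ring
    · simp only [latticeThree_apply, shear, Equiv.coe_fn_mk, s, mul_one, ← intSign_add]
      exact intSign_congr_neg (-k - 1) (by ring)
  have h2 : expSeries (fun p => e (latticeThree (p, 2))) (fun p => s (latticeThree (p, 2))) =
      expand 3 three_ne_zero (thetaPhi R) * expand 3 three_ne_zero (thetaPsi R) := by
    rw [thetaPhi, thetaPsi, ← expSeries_mul_exponent, ← expSeries_mul_exponent,
      expSeries_mul hphi3 hpsi3]
    refine Eq.trans ?_
      (expSeries_comp_equiv ((shear 1).trans ((Equiv.refl ℤ).prodCongr intReflect)) _ _)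
    refine expSeries_congr (fun ⟨i, k⟩ => ?_) fun ⟨i, k⟩ => ?_
    · simp only [latticeThree_apply, shear, Equiv.trans_apply, Equiv.coe_fn_mk,
        Equiv.prodCongr_apply, Prod.map, Equiv.refl_apply, intReflect_apply, e]
      push_cast [Fin.val_two]
      ring
    · simp only [latticeThree_apply, shear, Equiv.trans_apply, Equiv.coe_fn_mk,
        Equiv.prodCongr_apply, Prod.map, Equiv.refl_apply, intReflect_apply, s, mul_one,
        ← intSign_add]
      exact intSign_congr 0 (by ring)
  rw [thetaPsi, thetaDelta, expSeries_mul proper_psi proper_delta,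
    expSeries_eq_add_add (proper_psi.add proper_delta) _ latticeThree]
  change expSeries (fun p => e (latticeThree (p, 0))) (fun p => s (latticeThree (p, 0))) +
    expSeries (fun p => e (latticeThree (p, 1))) (fun p => s (latticeThree (p, 1))) +
    expSeries (fun p => e (latticeThree (p, 2))) (fun p => s (latticeThree (p, 2))) = _
  rw [h0, h1, h2, thetaPsi]
  ring

end Theta


/-! ### Product formulas for the theta series -/

section Telescoping

variable {R : Type*} [CommRing R]

/-- A finite form of `∑ (-1)^w x^(w²) = ∏ (1 - x^k) / (1 + x^k)`: the partial sum is the partial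
product times a correction whose terms are multiples of increasing powers of `x`. The sequence `t`
is `(-1)^j (-1; x)_j / (x; x)_j`. -/
theorem prod_mul_sum_neg_one_pow_sq (x : R) (t : ℕ → R) (h0 : t 0 = 1)
    (ht : ∀ j, t (j + 1) * (1 - x ^ (j + 1)) = -(1 + x ^ j) * t j) (n : ℕ) :
    (∏ k ∈ Finset.range n, (1 + x ^ (k + 1))) *
        (1 + ∑ k ∈ Finset.range n, 2 * (-1) ^ (k + 1) * x ^ ((k + 1) ^ 2)) =
      (∏ k ∈ Finset.range n, (1 - x ^ (k + 1))) *
        ∑ j ∈ Finset.range (n + 1), t j * x ^ (j * (n + 1)) := by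
  have hd : ∀ n, (∏ k ∈ Finset.range (n + 1), (1 - x ^ (k + 1))) * t (n + 1) =
      2 * (-1) ^ (n + 1) * ∏ k ∈ Finset.range n, (1 + x ^ (k + 1)) := by
    intro n
    induction n with
    | zero => simpa [h0, mul_comm, one_add_one_eq_two] using ht 0
    | succ n ih =>
      rw [Finset.prod_range_succ _ (n + 1), Finset.prod_range_succ (fun k => 1 + x ^ (k + 1))]
      linear_combination (∏ k ∈ Finset.range (n + 1), (1 - x ^ (k + 1))) * ht (n + 1) -
        (1 + x ^ (n + 1)) * ih
  -- The difference of consecutive corrections telescopes.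
  have htel : ∀ n m, (1 - x ^ (n + 1)) * ∑ j ∈ Finset.range m, t j * x ^ (j * (n + 1 + 1)) -
      (1 + x ^ (n + 1)) * ∑ j ∈ Finset.range m, t j * x ^ (j * (n + 1)) =
      x ^ (m * (n + 1)) * t m * (1 - x ^ m) := by
    intro n m
    induction m with
    | zero => simp
    | succ m ih =>
      rw [Finset.sum_range_succ, Finset.sum_range_succ]
      linear_combination ih - x ^ ((m + 1) * (n + 1)) * ht m
  induction n with
  | zero => simp [h0]
  | succ n ih =>
    rw [Finset.prod_range_succ, Finset.sum_range_succ, Finset.prod_range_succ,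
      Finset.sum_range_succ _ (n + 1)]
    have hdn := hd n
    rw [Finset.prod_range_succ] at hdn
    linear_combination (1 + x ^ (n + 1)) * ih -
      (∏ k ∈ Finset.range n, (1 - x ^ (k + 1))) * htel n (n + 1) -
      x ^ ((n + 1) ^ 2) * (1 + x ^ (n + 1)) * hdn

/-- A finite form of `∑ x^(s(s+1)/2) = ∏ (1 - x^(2k)) / (1 - x^(2k-1))`, with the exponents paired
as `s = 2k` and `s = 2k + 1`. The sequence `v` is `(x; x²)_s / (x²; x²)_s`. -/
theorem prod_mul_sum_triangular (x : R) (v : ℕ → R) (h0 : v 0 = 1)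
    (hv : ∀ j, v (j + 1) * (1 - x ^ (2 * j + 2)) = (1 - x ^ (2 * j + 1)) * v j) (n : ℕ) :
    (∏ k ∈ Finset.range n, (1 - x ^ (2 * k + 1))) *
        ∑ k ∈ Finset.range n, (x ^ (k * (2 * k + 1)) + x ^ ((k + 1) * (2 * k + 1))) =
      (∏ k ∈ Finset.range n, (1 - x ^ (2 * k + 2))) *
        ∑ j ∈ Finset.range n, v j * x ^ (j * (2 * n + 1)) := by
  have hd : ∀ n, (∏ k ∈ Finset.range n, (1 - x ^ (2 * k + 2))) * v n =
      ∏ k ∈ Finset.range n, (1 - x ^ (2 * k + 1)) := by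
    intro n
    induction n with
    | zero => simp [h0]
    | succ n ih =>
      rw [Finset.prod_range_succ, Finset.prod_range_succ]
      linear_combination (∏ k ∈ Finset.range n, (1 - x ^ (2 * k + 2))) * hv n +
        (1 - x ^ (2 * n + 1)) * ih
  have htel : ∀ n m, (1 - x ^ (2 * n + 2)) *
        ∑ j ∈ Finset.range m, v j * x ^ (j * (2 * (n + 1) + 1)) -
      (1 - x ^ (2 * n + 1)) * ∑ j ∈ Finset.range m, v j * x ^ (j * (2 * n + 1)) =
      x ^ (m * (2 * n + 1)) * v m * (1 - x ^ (2 * m)) := by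
    intro n m
    induction m with
    | zero => simp
    | succ m ih =>
      rw [Finset.sum_range_succ, Finset.sum_range_succ]
      linear_combination ih - x ^ ((m + 1) * (2 * n + 1)) * hv m
  induction n with
  | zero => simp
  | succ n ih =>
    rw [Finset.prod_range_succ, Finset.sum_range_succ, Finset.prod_range_succ,
      Finset.sum_range_succ _ n]
    linear_combination (1 - x ^ (2 * n + 1)) * ih -
      (∏ k ∈ Finset.range n, (1 - x ^ (2 * k + 2))) * htel n n -
      x ^ (n * (2 * n + 1)) * (1 - x ^ (4 * n + 2)) * hd n

theorem exists_seq_of_isUnit {p q : ℕ → R} (hp : ∀ j, IsUnit (p j)) :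
    ∃ t : ℕ → R, t 0 = 1 ∧ ∀ j, t (j + 1) * p j = q j * t j := by
  choose u hu using fun j => (hp j).exists_left_inv
  refine ⟨fun n => Nat.rec 1 (fun j y => q j * y * u j) n, rfl, fun j => ?_⟩
  simp only [mul_assoc, hu, mul_one]

theorem isUnit_one_sub_X_pow (k : ℕ) : IsUnit (1 - (X : R⟦X⟧) ^ (k + 1)) := by
  simp [isUnit_iff_constantCoeff]

theorem isUnit_one_add_X_pow (k : ℕ) : IsUnit (1 + (X : R⟦X⟧) ^ (k + 1)) := by
  simp [isUnit_iff_constantCoeff]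

theorem intSign_natCast (n : ℕ) : intSign R n = (-1) ^ n := by
  simp [intSign]

theorem intSign_neg (n : ℤ) : intSign R (-n) = intSign R n :=
  intSign_congr (-n) (by ring)

theorem sum_Icc_thetaPhi (n : ℕ) :
    ∑ w ∈ Finset.Icc (-n : ℤ) n, C (intSign R w) * (X : R⟦X⟧) ^ (w ^ 2).toNat =
      1 + ∑ k ∈ Finset.range n, 2 * (-1) ^ (k + 1) * X ^ ((k + 1) ^ 2) := by
  induction n with
  | zero => simp [intSign]
  | succ n ih =>
    have hI : Finset.Icc (-(n + 1 : ℕ) : ℤ) (n + 1 : ℕ) =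
        insert ((n + 1 : ℕ) : ℤ) (insert (-(n + 1 : ℕ) : ℤ) (Finset.Icc (-n : ℤ) n)) := by
      ext m
      simp only [Finset.mem_Icc, Finset.mem_insert]
      omega
    have hexp : (((n + 1 : ℕ) : ℤ) ^ 2).toNat = (n + 1) ^ 2 := by
      rw [← Nat.cast_pow, Int.toNat_natCast]
    rw [hI, Finset.sum_insert, Finset.sum_insert, ih, Finset.sum_range_succ, neg_sq, intSign_neg,
      intSign_natCast, hexp]
    · simp only [map_pow, map_neg, map_one]
      ring
    · simp only [Finset.mem_Icc]
      omega
    · simp only [Finset.mem_Icc, Finset.mem_insert]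
      omega

theorem sum_Ico_thetaPsi (n : ℕ) :
    ∑ m ∈ Finset.Ico (-n : ℤ) n, C (intSign R m) * (X : R⟦X⟧) ^ (2 * m ^ 2 + m).toNat =
      ∑ k ∈ Finset.range n, ((-X) ^ (k * (2 * k + 1)) + (-X) ^ ((k + 1) * (2 * k + 1))) := by
  induction n with
  | zero => simp
  | succ n ih =>
    have hI : Finset.Ico (-(n + 1 : ℕ) : ℤ) (n + 1 : ℕ) =
        insert (n : ℤ) (insert (-(n + 1 : ℕ) : ℤ) (Finset.Ico (-n : ℤ) n)) := by
      ext m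
      simp only [Finset.mem_Ico, Finset.mem_insert]
      omega
    have hexp : (2 * (n : ℤ) ^ 2 + n).toNat = n * (2 * n + 1) := by
      rw [← Int.toNat_natCast (n * (2 * n + 1))]
      congr 1
      push_cast
      ring
    have hexp' : (2 * (-(n + 1 : ℕ) : ℤ) ^ 2 + -(n + 1 : ℕ)).toNat = (n + 1) * (2 * n + 1) := by
      rw [← Int.toNat_natCast ((n + 1) * (2 * n + 1))]
      congr 1
      push_cast
      ring
    have hodd : (-1 : R⟦X⟧) ^ (2 * n + 1) = -1 := Odd.neg_one_pow ⟨n, rfl⟩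
    rw [hI, Finset.sum_insert, Finset.sum_insert, ih, Finset.sum_range_succ, intSign_neg,
      intSign_natCast, intSign_natCast, hexp, hexp', neg_pow X, neg_pow X ((n + 1) * _),
      mul_comm n, mul_comm (n + 1) (2 * n + 1), pow_mul (-1 : R⟦X⟧), pow_mul (-1 : R⟦X⟧), hodd]
    · simp only [map_pow, map_neg, map_one]
      ring
    · simp only [Finset.mem_Ico]
      omega
    · simp only [Finset.mem_Ico, Finset.mem_insert]
      omega

theorem X_pow_dvd_prod_mul_thetaPhi_sub (n : ℕ) :
    X ^ n ∣ (∏ k ∈ Finset.range n, (1 + X ^ (k + 1))) * thetaPhi R -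
      ∏ k ∈ Finset.range n, (1 - X ^ (k + 1)) := by
  obtain ⟨t, h0, ht⟩ := exists_seq_of_isUnit (q := fun j => -(1 + (X : R⟦X⟧) ^ j))
    (isUnit_one_sub_X_pow (R := R))
  obtain ⟨a, ha⟩ := (pow_dvd_pow X n.le_succ).trans <|
    X_pow_dvd_expSeries_sub_sum proper_phi.nonneg (intSign R) (Finset.Icc (-n : ℤ) n) n (by
      intro m hm
      rw [Finset.mem_Icc]
      constructor <;> nlinarith)
  rw [sum_Icc_thetaPhi] at ha
  have hfin := prod_mul_sum_neg_one_pow_sq X t h0 ht n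
  obtain ⟨b, hb⟩ : X ^ n ∣ ∑ j ∈ Finset.range (n + 1), t j * (X : R⟦X⟧) ^ (j * (n + 1)) - 1 := by
    rw [Finset.sum_range_succ', zero_mul, pow_zero, h0, one_mul, add_sub_cancel_right]
    exact Finset.dvd_sum fun j _ => (pow_dvd_pow X (by nlinarith)).mul_left _
  refine ⟨(∏ k ∈ Finset.range n, (1 + X ^ (k + 1))) * a +
    (∏ k ∈ Finset.range n, (1 - X ^ (k + 1))) * b, ?_⟩
  rw [thetaPhi]
  linear_combination (∏ k ∈ Finset.range n, (1 + X ^ (k + 1))) * ha + hfin +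
    (∏ k ∈ Finset.range n, (1 - X ^ (k + 1))) * hb

theorem X_pow_dvd_prod_mul_thetaPsi_sub {n : ℕ} (hn : n ≠ 0) :
    X ^ n ∣ (∏ k ∈ Finset.range n, (1 + X ^ (2 * k + 1))) * thetaPsi R -
      ∏ k ∈ Finset.range n, (1 - X ^ (2 * k + 2)) := by
  have heven : ∀ k : ℕ, (-X : R⟦X⟧) ^ (2 * k + 2) = X ^ (2 * k + 2) := fun k =>
    Even.neg_pow ⟨k + 1, by ring⟩ X
  have hodd : ∀ k : ℕ, (-X : R⟦X⟧) ^ (2 * k + 1) = -X ^ (2 * k + 1) := fun k =>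
    Odd.neg_pow ⟨k, rfl⟩ X
  obtain ⟨v, h0, hv⟩ := exists_seq_of_isUnit (q := fun j => 1 - (-X : R⟦X⟧) ^ (2 * j + 1))
    (p := fun j => 1 - (-X : R⟦X⟧) ^ (2 * j + 2))
    fun j => by rw [heven]; exact isUnit_one_sub_X_pow _
  obtain ⟨m, rfl⟩ : ∃ m, n = m + 1 := Nat.exists_eq_succ_of_ne_zero hn
  obtain ⟨a, ha⟩ :=
    X_pow_dvd_expSeries_sub_sum proper_psi.nonneg (intSign R)
      (Finset.Ico (-(m + 1 : ℕ) : ℤ) (m + 1 : ℕ)) m (by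
      intro i hi
      rw [Finset.mem_Ico]
      push_cast
      constructor <;> nlinarith)
  rw [sum_Ico_thetaPsi] at ha
  have hfin := prod_mul_sum_triangular (-X) v h0 hv (m + 1)
  simp only [heven, hodd, sub_neg_eq_add] at hfin
  obtain ⟨b, hb⟩ : X ^ (m + 1) ∣
      ∑ j ∈ Finset.range (m + 1), v j * (-X : R⟦X⟧) ^ (j * (2 * (m + 1) + 1)) - 1 := by
    rw [Finset.sum_range_succ', zero_mul, pow_zero, h0, one_mul, add_sub_cancel_right]
    refine Finset.dvd_sum fun j _ => Dvd.dvd.mul_left ?_ _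
    rw [neg_pow]
    exact (pow_dvd_pow X (by nlinarith)).mul_left _
  refine ⟨(∏ k ∈ Finset.range (m + 1), (1 + X ^ (2 * k + 1))) * a +
    (∏ k ∈ Finset.range (m + 1), (1 - X ^ (2 * k + 2))) * b, ?_⟩
  rw [thetaPsi]
  linear_combination (∏ k ∈ Finset.range (m + 1), (1 + X ^ (2 * k + 1))) * ha + hfin +
    (∏ k ∈ Finset.range (m + 1), (1 - X ^ (2 * k + 2))) * hb

end Telescoping

/-! ### The generating function of the signed cubic partitions -/

section SignedCount

variable {α : Type*}

/-- The multisets with elements in `S` whose sizes, measured by `f`, add up to `n`. -/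
def multisetsOfSize (f : α → ℕ) (S : Finset α) (n : ℕ) : Set (Multiset α) :=
  {m | (∀ x ∈ m, x ∈ S) ∧ (m.map f).sum = n}

theorem finite_multisetsOfSize {f : α → ℕ} {S : Finset α} (hf : ∀ x ∈ S, 0 < f x) (n : ℕ) :
    (multisetsOfSize f S n).Finite := by
  classical
  refine (Multiset.finite_toSet (n • S.val).powerset).subset fun m hm => ?_
  have hcard : Multiset.card m ≤ n := by
    have h := Multiset.card_nsmul_le_sum (s := m.map f) (a := 1) (by
      intro y hy
      obtain ⟨x, hx, rfl⟩ := Multiset.mem_map.1 hy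
      exact hf x (hm.1 x hx))
    simpa [hm.2] using h
  rw [Set.mem_ofPred_eq, Multiset.mem_powerset, Multiset.le_iff_count]
  intro a
  by_cases ha : a ∈ m
  · rw [Multiset.count_nsmul, Multiset.count_eq_one_of_mem S.nodup (hm.1 a ha), mul_one]
    exact (Multiset.count_le_card a m).trans hcard
  · simp [Multiset.count_eq_zero_of_notMem ha]

/-- The generating function of the multisets on `S`, each counted with the sign of its number of
elements. -/
noncomputable def signedSeries (R : Type*) [CommRing R] (f : α → ℕ) (S : Finset α) : R⟦X⟧ :=
  PowerSeries.mk fun n => ∑ᶠ m ∈ multisetsOfSize f S n, (-1) ^ Multiset.card m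

variable {R : Type*} [CommRing R]

theorem multisetsOfSize_insert [DecidableEq α] (f : α → ℕ) (S : Finset α) (a : α) (n : ℕ) :
    multisetsOfSize f (insert a S) (n + f a) =
      multisetsOfSize f S (n + f a) ∪ (a ::ₘ ·) '' multisetsOfSize f (insert a S) n := by
  ext m
  simp only [multisetsOfSize, Set.mem_union, Set.mem_image, Set.mem_ofPred_eq]
  constructor
  · rintro ⟨h1, h2⟩
    by_cases ha : a ∈ m
    · obtain ⟨m, rfl⟩ := Multiset.exists_cons_of_mem ha
      refine Or.inr ⟨m, ⟨fun x hx => h1 x (Multiset.mem_cons_of_mem hx), ?_⟩, rfl⟩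
      rw [Multiset.map_cons, Multiset.sum_cons] at h2
      omega
    · refine Or.inl ⟨fun x hx => (Finset.mem_insert.1 (h1 x hx)).resolve_left ?_, h2⟩
      rintro rfl
      exact ha hx
  · rintro (⟨h1, h2⟩ | ⟨m, ⟨h1, h2⟩, rfl⟩)
    · exact ⟨fun x hx => Finset.mem_insert_of_mem (h1 x hx), h2⟩
    · refine ⟨fun x hx => ?_, by rw [Multiset.map_cons, Multiset.sum_cons]; omega⟩
      rcases Multiset.mem_cons.1 hx with rfl | hx
      · exact Finset.mem_insert_self _ _
      · exact h1 x hx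

theorem multisetsOfSize_insert_of_lt [DecidableEq α] {f : α → ℕ} (S : Finset α) {a : α} {n : ℕ}
    (h : n < f a) : multisetsOfSize f (insert a S) n = multisetsOfSize f S n := by
  ext m
  simp only [multisetsOfSize, Set.mem_ofPred_eq]
  refine and_congr_left fun hm => forall₂_congr fun x hx => ?_
  rw [Finset.mem_insert, or_iff_right]
  rintro rfl
  have := Multiset.single_le_sum (by simp) _ (Multiset.mem_map_of_mem f hx)
  omega

theorem signedSeries_insert_mul [DecidableEq α] {f : α → ℕ} {S : Finset α} {a : α} (ha : a ∉ S)
    (hf : ∀ x ∈ insert a S, 0 < f x) :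
    signedSeries R f (insert a S) * (1 + X ^ f a) = signedSeries R f S := by
  ext n
  rw [mul_add, mul_one, map_add, coeff_mul_X_pow']
  simp only [signedSeries, coeff_mk]
  split_ifs with h
  · obtain ⟨n, rfl⟩ := Nat.exists_eq_add_of_le' h
    rw [multisetsOfSize_insert, finsum_mem_union, finsum_mem_image, Nat.add_sub_cancel, add_assoc,
      ← finsum_mem_add_distrib (finite_multisetsOfSize hf n)]
    · simp [pow_succ]
    · exact fun _ _ _ _ => (Multiset.cons_inj_right a).1
    · rw [Set.disjoint_left]
      rintro _ h1 ⟨m, -, rfl⟩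
      exact ha (h1.1 a (Multiset.mem_cons_self a m))
    · exact finite_multisetsOfSize (fun x hx => hf x (Finset.mem_insert_of_mem hx)) _
    · exact (finite_multisetsOfSize hf n).image _
  · rw [multisetsOfSize_insert_of_lt S (not_le.1 h), add_zero]

theorem signedSeries_mul_prod {f : α → ℕ} (S : Finset α) (hf : ∀ x ∈ S, 0 < f x) :
    signedSeries R f S * ∏ x ∈ S, (1 + X ^ f x) = 1 := by
  classical
  induction S using Finset.induction_on with
  | empty =>
    have : ∀ n, multisetsOfSize f ∅ n = if n = 0 then {0} else ∅ := by
      intro n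
      ext m
      split_ifs with hn <;>
        simp only [multisetsOfSize, Set.mem_ofPred_eq, Finset.notMem_empty, imp_false,
          ← Multiset.eq_zero_iff_forall_notMem, Set.mem_singleton_iff, Set.mem_empty_iff_false,
          iff_false, not_and]
      · refine ⟨And.left, ?_⟩
        rintro rfl
        simp [hn]
      · rintro rfl
        simpa using Ne.symm hn
    ext n
    rw [Finset.prod_empty, mul_one, signedSeries, coeff_mk, coeff_one, this]
    split_ifs <;> simp
  | insert a S ha ih =>
    rw [Finset.prod_insert ha, ← mul_assoc, signedSeries_insert_mul ha hf]
    exact ih fun x hx => hf x (Finset.mem_insert_of_mem hx)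

theorem cubicDiff_eq_finsum (n : ℕ) :
    (cubicDiff n : R) = ∑ᶠ p : CubicPartition n, (-1) ^ Multiset.card p.parts := by
  classical
  have := Fintype.ofFinite (CubicPartition n)
  have hodd : Finset.univ.filter (fun p : CubicPartition n => Odd p.numParts) =
      Finset.univ.filter fun p : CubicPartition n => ¬ Even p.numParts := by
    simp
  rw [cubicDiff, cubicEven, cubicOdd, Nat.card_eq_fintype_card, Nat.card_eq_fintype_card,
    Fintype.card_subtype, Fintype.card_subtype, hodd, finsum_eq_sum_of_fintype,
    ← Finset.sum_filter_add_sum_filter_not Finset.univ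
      (fun p : CubicPartition n => Even p.numParts)]
  have h1 : ∀ p ∈ Finset.univ.filter (fun p : CubicPartition n => Even p.numParts),
      (-1 : R) ^ Multiset.card p.parts = 1 :=
    fun p hp => Even.neg_one_pow (Finset.mem_filter.1 hp).2
  have h2 : ∀ p ∈ Finset.univ.filter (fun p : CubicPartition n => ¬ Even p.numParts),
      (-1 : R) ^ Multiset.card p.parts = -1 :=
    fun p hp => Odd.neg_one_pow (Nat.not_even_iff_odd.1 (Finset.mem_filter.1 hp).2)
  rw [Finset.sum_congr rfl h1, Finset.sum_congr rfl h2]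
  simp [sub_eq_add_neg]

/-- The coloured parts `(k, false)` and `(2k, true)` with `1 ≤ k ≤ n`. -/
def colouredParts (n : ℕ) : Finset (ℕ × Bool) :=
  (Finset.range n).image (fun k => (k + 1, false)) ∪
    (Finset.range n).image fun k => (2 * k + 2, true)

theorem mem_colouredParts {n : ℕ} {x : ℕ × Bool} : x ∈ colouredParts n ↔
    (∃ k < n, (k + 1, false) = x) ∨ ∃ k < n, (2 * k + 2, true) = x := by
  simp [colouredParts]

theorem colouredParts_pos {n : ℕ} : ∀ x ∈ colouredParts n, 0 < x.1 := by
  intro x hx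
  rcases mem_colouredParts.1 hx with ⟨k, -, rfl⟩ | ⟨k, -, rfl⟩ <;> simp

theorem prod_colouredParts (n : ℕ) : ∏ x ∈ colouredParts n, (1 + (X : R⟦X⟧) ^ x.1) =
    (∏ k ∈ Finset.range n, (1 + X ^ (k + 1))) *
      ∏ k ∈ Finset.range n, (1 + X ^ (2 * k + 2)) := by
  rw [colouredParts, Finset.prod_union, Finset.prod_image, Finset.prod_image]
  · intro a _ b _ h
    simpa using h
  · intro a _ b _ h
    simpa using h
  · rw [Finset.disjoint_left]
    intro x hx hx'
    simp only [Finset.mem_image] at hx hx'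
    obtain ⟨a, -, rfl⟩ := hx
    obtain ⟨b, -, hb⟩ := hx'
    simp at hb

theorem range_parts {n N : ℕ} (h : n ≤ N) :
    Set.range (CubicPartition.parts : CubicPartition n → _) =
      multisetsOfSize Prod.fst (colouredParts N) n := by
  ext m
  constructor
  · rintro ⟨p, rfl⟩
    refine ⟨fun x hx => ?_, p.size_sum⟩
    have hle := Multiset.single_le_sum (by simp) _ (Multiset.mem_map_of_mem Prod.fst hx)
    rw [p.size_sum] at hle
    have hpos := p.size_pos x hx
    have hcol := p.odd_colour x hx
    obtain ⟨k, c⟩ := x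
    simp only at hle hpos hcol
    rw [mem_colouredParts]
    rcases c with - | -
    · exact Or.inl ⟨k - 1, by omega, by simp; omega⟩
    · have heven : Even k := by
        rw [← Nat.not_odd_iff_even]
        exact fun hk => by simpa using hcol hk
      obtain ⟨i, rfl⟩ := heven
      exact Or.inr ⟨i - 1, by omega, by simp; omega⟩
  · rintro ⟨h1, h2⟩
    refine ⟨⟨m, fun x hx => colouredParts_pos x (h1 x hx), fun x hx hodd => ?_, h2⟩, rfl⟩
    rcases mem_colouredParts.1 (h1 x hx) with ⟨k, -, rfl⟩ | ⟨k, -, rfl⟩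
    · rfl
    · exact absurd hodd (Nat.not_odd_iff_even.2 ⟨k + 1, by ring⟩)

variable (R)

/-- The generating function of `cubicDiff`, with coefficients in `R`. -/
noncomputable def cubicSeries : R⟦X⟧ := PowerSeries.mk fun n => (cubicDiff n : R)

variable {R}

theorem X_pow_dvd_cubicSeries_mul_sub_one (n : ℕ) :
    X ^ n ∣ cubicSeries R * ((∏ k ∈ Finset.range n, (1 + X ^ (k + 1))) *
      ∏ k ∈ Finset.range n, (1 + X ^ (2 * k + 2))) - 1 := by
  have h : X ^ n ∣ cubicSeries R - signedSeries R Prod.fst (colouredParts n) := by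
    rw [X_pow_dvd_iff]
    intro m hm
    rw [map_sub, cubicSeries, signedSeries, coeff_mk, coeff_mk, cubicDiff_eq_finsum,
      ← range_parts hm.le, finsum_mem_range fun p q => CubicPartition.ext, sub_self]
  have h1 := signedSeries_mul_prod (R := R) (colouredParts n) colouredParts_pos
  rw [← prod_colouredParts]
  nth_rw 2 [← h1]
  rw [← sub_mul]
  exact h.mul_right _

theorem prod_even_mul_prod_odd (n : ℕ) :
    (∏ k ∈ Finset.range n, (1 + (X : R⟦X⟧) ^ (2 * k + 2))) *
      ∏ k ∈ Finset.range n, (1 + (X : R⟦X⟧) ^ (2 * k + 1)) =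
      ∏ k ∈ Finset.range (n + n), (1 + (X : R⟦X⟧) ^ (k + 1)) := by
  induction n with
  | zero => simp
  | succ n ih =>
    rw [show n + 1 + (n + 1) = n + n + 1 + 1 by ring, Finset.prod_range_succ,
      Finset.prod_range_succ, Finset.prod_range_succ, Finset.prod_range_succ, ← ih]
    ring

theorem X_pow_dvd_prod_sub_prod (n m : ℕ) :
    X ^ n ∣ (∏ k ∈ Finset.range (n + m), (1 + (X : R⟦X⟧) ^ (k + 1))) -
      ∏ k ∈ Finset.range n, (1 + X ^ (k + 1)) := by
  induction m with
  | zero => simp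
  | succ m ih =>
    rw [← add_assoc, Finset.prod_range_succ, mul_one_add, add_sub_right_comm]
    exact ih.add ((pow_dvd_pow X (by omega)).mul_left _)

/-- The generating function of `cubicDiff` is `φ(-q) / ψ(-q)`. -/
theorem cubicSeries_mul_thetaPsi : cubicSeries R * thetaPsi R = thetaPhi R := by
  refine eq_of_forall_X_pow_dvd_sub fun N => ?_
  set n := N + 1 with hn
  set a := ∏ k ∈ Finset.range n, (1 + (X : R⟦X⟧) ^ (k + 1)) with ha
  set b := ∏ k ∈ Finset.range n, (1 + (X : R⟦X⟧) ^ (2 * k + 2)) with hb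
  set c := ∏ k ∈ Finset.range n, (1 + (X : R⟦X⟧) ^ (2 * k + 1)) with hc
  set d := ∏ k ∈ Finset.range n, (1 - (X : R⟦X⟧) ^ (k + 1)) with hd
  obtain ⟨u, hu⟩ := X_pow_dvd_cubicSeries_mul_sub_one (R := R) n
  obtain ⟨v, hv⟩ := X_pow_dvd_prod_mul_thetaPhi_sub (R := R) n
  obtain ⟨w, hw⟩ := X_pow_dvd_prod_mul_thetaPsi_sub (R := R) (n := n) (by omega)
  obtain ⟨y, hy⟩ := X_pow_dvd_prod_sub_prod (R := R) n n
  have had : ∏ k ∈ Finset.range n, (1 - (X : R⟦X⟧) ^ (2 * k + 2)) = a * d := by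
    rw [ha, hd, ← Finset.prod_mul_distrib]
    exact Finset.prod_congr rfl fun k _ => by ring
  rw [← prod_even_mul_prod_odd] at hy
  simp only [← ha, ← hb, ← hc, ← hd, had] at hu hv hw hy
  have hunit : IsUnit (a * b * c) := by
    rw [ha, hb, hc, ← Finset.prod_mul_distrib, ← Finset.prod_mul_distrib]
    exact (Finset.prod_induction _ IsUnit (fun _ _ => IsUnit.mul) isUnit_one fun k _ =>
      ((isUnit_one_add_X_pow k).mul (isUnit_one_add_X_pow (2 * k + 1))).mul
        (isUnit_one_add_X_pow (2 * k)))
  rw [← hunit.dvd_mul_left]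
  refine ⟨c * thetaPsi R * u + w - b * c * v - d * y, ?_⟩
  linear_combination c * thetaPsi R * hu + hw - b * c * hv - d * hy

end SignedCount


/-! ### Dissection of the generating function modulo 3 -/

section Dissection

variable {R : Type*} [CommRing R]

/-- The series `a(q³) + q b(q³) + q² c(q³)`. -/
noncomputable def interleave (a b c : R⟦X⟧) : R⟦X⟧ :=
  expand 3 three_ne_zero a + X * expand 3 three_ne_zero b + X ^ 2 * expand 3 three_ne_zero c

theorem coeff_three_mul_interleave (a b c : R⟦X⟧) (n : ℕ) :
    coeff (3 * n) (interleave a b c) = coeff n a := by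
  rw [interleave, map_add, map_add, coeff_expand_mul]
  cases n with
  | zero => simp
  | succ n =>
    rw [show 3 * (n + 1) = 3 * n + 1 + 2 by ring, coeff_X_pow_mul, coeff_succ_X_mul, coeff_expand,
      coeff_expand, if_neg (by omega : ¬ 3 ∣ 3 * n + 1 + 1), if_neg (by omega : ¬ 3 ∣ 3 * n + 1),
      add_zero, add_zero]

theorem coeff_three_mul_add_one_interleave (a b c : R⟦X⟧) (n : ℕ) :
    coeff (3 * n + 1) (interleave a b c) = coeff n b := by
  rw [interleave, map_add, map_add, coeff_succ_X_mul, coeff_expand_mul, coeff_X_pow_mul',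
    coeff_expand, coeff_expand, if_neg (by omega : ¬ 3 ∣ 3 * n + 1)]
  split_ifs <;> first | omega | simp

theorem coeff_three_mul_add_two_interleave (a b c : R⟦X⟧) (n : ℕ) :
    coeff (3 * n + 2) (interleave a b c) = coeff n c := by
  rw [interleave, map_add, map_add, coeff_X_pow_mul, coeff_succ_X_mul, coeff_expand_mul,
    coeff_expand, coeff_expand, if_neg (by omega : ¬ 3 ∣ 3 * n + 2),
    if_neg (by omega : ¬ 3 ∣ 3 * n + 1)]
  simp

theorem exists_eq_interleave (f : R⟦X⟧) : ∃ a b c, f = interleave a b c := by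
  refine ⟨PowerSeries.mk fun n => coeff (3 * n) f, PowerSeries.mk fun n => coeff (3 * n + 1) f,
    PowerSeries.mk fun n => coeff (3 * n + 2) f, ?_⟩
  ext n
  obtain ⟨k, rfl | rfl | rfl⟩ : ∃ k, n = 3 * k ∨ n = 3 * k + 1 ∨ n = 3 * k + 2 :=
    ⟨n / 3, by omega⟩
  · rw [coeff_three_mul_interleave, coeff_mk]
  · rw [coeff_three_mul_add_one_interleave, coeff_mk]
  · rw [coeff_three_mul_add_two_interleave, coeff_mk]

theorem interleave_mul_expand (a b c f : R⟦X⟧) :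
    interleave a b c * expand 3 three_ne_zero f = interleave (a * f) (b * f) (c * f) := by
  simp only [interleave, map_mul]
  ring

theorem interleave_inj {a b c a' b' c' : R⟦X⟧} (h : interleave a b c = interleave a' b' c') :
    b = b' ∧ c = c' := by
  constructor <;> ext n
  · rw [← coeff_three_mul_add_one_interleave a b c, h, coeff_three_mul_add_one_interleave]
  · rw [← coeff_three_mul_add_two_interleave a b c, h, coeff_three_mul_add_two_interleave]

theorem pow_three_eq_expand (f : (ZMod 3)⟦X⟧) : f ^ 3 = expand 3 three_ne_zero f := by
  have h := MvPowerSeries.map_frobenius_expand (p := 3) three_ne_zero (f := f)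
  rw [ZMod.frobenius_zmod, MvPowerSeries.map_id] at h
  exact h.symm

theorem thetaPsi_ne_zero [Nontrivial R] : thetaPsi R ≠ 0 := by
  intro h
  have := X_pow_dvd_prod_mul_thetaPsi_sub (R := R) one_ne_zero
  rw [h, mul_zero, zero_sub, dvd_neg, pow_one, X_dvd_iff] at this
  simp at this

/-- The generating functions of `cubicDiff (3n + 1)` and `cubicDiff (3n + 2)` modulo `3`. Cubing is
`q ↦ q³` modulo `3`, hence `φ(-q) / ψ(-q) = φ(-q) ψ(-q)² / ψ(-q³)`; the numerator has an explicit
dissection, and `thetaPsi_mul_thetaDelta` makes `ψ(-q)` divide the two parts in question. -/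
theorem exists_cubicSeries_eq_interleave : ∃ a, cubicSeries (ZMod 3) =
    interleave a ((thetaPiZero (ZMod 3) - thetaPiOne (ZMod 3)) * thetaDelta (ZMod 3))
      (expand 3 three_ne_zero (thetaPsi (ZMod 3)) * thetaDelta (ZMod 3)) := by
  obtain ⟨a, b, c, habc⟩ := exists_eq_interleave (cubicSeries (ZMod 3))
  have h3 : (3 : (ZMod 3)⟦X⟧) = 0 := by
    rw [← map_ofNat C 3, show (OfNat.ofNat 3 : ZMod 3) = 0 from rfl, map_zero]
  have hlat := thetaPsi_mul_thetaDelta (R := ZMod 3)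
  have hmain : cubicSeries (ZMod 3) * expand 3 three_ne_zero (thetaPsi (ZMod 3)) =
      thetaPhi (ZMod 3) * thetaPsi (ZMod 3) ^ 2 := by
    rw [← pow_three_eq_expand, ← cubicSeries_mul_thetaPsi]
    ring
  have hphi := thetaPhi_dissection (R := ZMod 3)
  have hpsi := thetaPsi_dissection (R := ZMod 3)
  set Φ := thetaPhi (ZMod 3)
  set Ψ := thetaPsi (ZMod 3)
  set P := thetaPiZero (ZMod 3) - thetaPiOne (ZMod 3)
  set Ω := thetaOmega (ZMod 3)
  set Δ := thetaDelta (ZMod 3)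
  have hnum : Φ * Ψ ^ 2 = interleave
      (expand 3 three_ne_zero Φ * P ^ 2 + X * (Ω * expand 3 three_ne_zero Ψ ^ 2))
      (P * (expand 3 three_ne_zero Φ * expand 3 three_ne_zero Ψ + Ω * P))
      (expand 3 three_ne_zero Ψ *
        (expand 3 three_ne_zero Φ * expand 3 three_ne_zero Ψ + Ω * P)) := by
    simp only [interleave, map_add, map_mul, map_pow, expand_X]
    set φ := expand 3 three_ne_zero (expand 3 three_ne_zero Φ)
    set ψ := expand 3 three_ne_zero (expand 3 three_ne_zero Ψ)
    set p := expand 3 three_ne_zero P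
    set ω := expand 3 three_ne_zero Ω
    linear_combination Ψ ^ 2 * hphi + (φ - 2 * (X * ω)) * (Ψ + (p - X * ψ)) * hpsi +
      (-X * p * ψ * φ - X * ω * p ^ 2 + X ^ 2 * p * ψ * ω - X ^ 3 * ω * ψ ^ 2) * h3
  rw [habc, interleave_mul_expand, hnum, ← hlat] at hmain
  obtain ⟨hb, hc⟩ := interleave_inj hmain
  refine ⟨a, ?_⟩
  rw [habc]
  congr 1
  · exact mul_right_cancel₀ thetaPsi_ne_zero (hb.trans (by ring))
  · exact mul_right_cancel₀ thetaPsi_ne_zero (hc.trans (by ring))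

theorem cubicDiff_three_mul_add_one (n : ℕ) : (cubicDiff (3 * n + 1) : ZMod 3) =
    coeff n ((thetaPiZero (ZMod 3) - thetaPiOne (ZMod 3)) * thetaDelta (ZMod 3)) := by
  obtain ⟨a, ha⟩ := exists_cubicSeries_eq_interleave
  rw [← coeff_three_mul_add_one_interleave a _ _, ← ha, cubicSeries, coeff_mk]

theorem cubicDiff_three_mul_add_two (n : ℕ) : (cubicDiff (3 * n + 2) : ZMod 3) =
    coeff n (expand 3 three_ne_zero (thetaPsi (ZMod 3)) * thetaDelta (ZMod 3)) := by
  obtain ⟨a, ha⟩ := exists_cubicSeries_eq_interleave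
  rw [← coeff_three_mul_add_two_interleave a _ _, ← ha, cubicSeries, coeff_mk]

theorem expand_thetaPsi_mul_thetaDelta : expand 3 three_ne_zero (thetaPsi R) * thetaDelta R =
    interleave (thetaPsi R * thetaEta R) 0
      (thetaPsi R * expand 3 three_ne_zero (thetaDelta R)) := by
  conv_lhs => rw [thetaDelta_dissection]
  simp only [interleave, map_mul, map_zero]
  ring

theorem thetaPsi_mul_expand_thetaDelta : thetaPsi R * expand 3 three_ne_zero (thetaDelta R) =
    interleave ((thetaPiZero R - thetaPiOne R) * thetaDelta R)
      (-(expand 3 three_ne_zero (thetaPsi R) * thetaDelta R)) 0 := by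
  conv_lhs => rw [thetaPsi_dissection]
  simp only [interleave, map_mul, map_zero, map_neg]
  ring

theorem cubicDiff_nine_mul_add_five (n : ℕ) : (cubicDiff (9 * n + 5) : ZMod 3) = 0 := by
  rw [show 9 * n + 5 = 3 * (3 * n + 1) + 2 by ring, cubicDiff_three_mul_add_two,
    expand_thetaPsi_mul_thetaDelta, coeff_three_mul_add_one_interleave, map_zero]

theorem cubicDiff_nine_mul_add_eight (n : ℕ) : (cubicDiff (9 * n + 8) : ZMod 3) =
    coeff n (thetaPsi (ZMod 3) * expand 3 three_ne_zero (thetaDelta (ZMod 3))) := by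
  rw [show 9 * n + 8 = 3 * (3 * n + 2) + 2 by ring, cubicDiff_three_mul_add_two,
    expand_thetaPsi_mul_thetaDelta, coeff_three_mul_add_two_interleave]

theorem cubicDiff_27_mul_add_eight (n : ℕ) :
    (cubicDiff (27 * n + 8) : ZMod 3) = cubicDiff (3 * n + 1) := by
  rw [show 27 * n + 8 = 9 * (3 * n) + 8 by ring, cubicDiff_nine_mul_add_eight,
    thetaPsi_mul_expand_thetaDelta, coeff_three_mul_interleave, cubicDiff_three_mul_add_one]

/-- Multiplying `8N - 1` by `9` negates `cubicDiff N` modulo `3` when `N = 3n + 2`; this drives the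
induction on `j` in both families of congruences. -/
theorem cubicDiff_27_mul_add_17 (n : ℕ) :
    (cubicDiff (27 * n + 17) : ZMod 3) = -cubicDiff (3 * n + 2) := by
  rw [show 27 * n + 17 = 9 * (3 * n + 1) + 8 by ring, cubicDiff_nine_mul_add_eight,
    thetaPsi_mul_expand_thetaDelta, coeff_three_mul_add_one_interleave,
    cubicDiff_three_mul_add_two, map_neg]

theorem cubicDiff_27_mul_add_26 (n : ℕ) : (cubicDiff (27 * n + 26) : ZMod 3) = 0 := by
  rw [show 27 * n + 26 = 9 * (3 * n + 2) + 8 by ring, cubicDiff_nine_mul_add_eight,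
    thetaPsi_mul_expand_thetaDelta, coeff_three_mul_add_two_interleave, map_zero]

end Dissection

theorem exists_nine_pow_eq (j : ℕ) : ∃ t, 9 ^ j = 8 * t + 1 := by
  induction j with
  | zero => exact ⟨0, rfl⟩
  | succ j ih =>
    obtain ⟨t, ht⟩ := ih
    exact ⟨9 * t + 1, by rw [pow_succ, ht]; ring⟩

/-- Both fractions are integers (`9 ^ j` is `1` modulo `8`), so the division in `ℕ` is exact. -/
theorem theorem1p3 :
    (∀ n : ℕ, cubicDiff (3 * n + 1) ≡ cubicDiff (27 * n + 8) [ZMOD 3]) ∧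
    (∀ j n : ℕ, cubicDiff (9 ^ (j + 1) * n + (39 * 9 ^ j + 1) / 8) ≡ 0 [ZMOD 3]) ∧
    (∀ j n : ℕ, cubicDiff (3 * 9 ^ (j + 1) * n + (23 * 9 ^ (j + 1) + 1) / 8) ≡ 0 [ZMOD 3]) := by
  have cast {a b : ℤ} : a ≡ b [ZMOD 3] ↔ (a : ZMod 3) = b :=
    (ZMod.intCast_eq_intCast_iff a b 3).symm
  refine ⟨fun n => cast.2 (cubicDiff_27_mul_add_eight n).symm, fun j n => cast.2 ?_,
    fun j n => cast.2 ?_⟩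
  · rw [Int.cast_zero]
    induction j with
    | zero => simpa using cubicDiff_nine_mul_add_five n
    | succ j ih =>
      obtain ⟨t, ht⟩ := exists_nine_pow_eq j
      rw [pow_succ, ht, show (39 * (8 * t + 1) + 1) / 8 = 39 * t + 5 by omega] at ih
      rw [pow_succ, pow_succ, ht,
        show (39 * ((8 * t + 1) * 9) + 1) / 8 = 351 * t + 44 by omega,
        show (8 * t + 1) * 9 * 9 * n + (351 * t + 44) =
          27 * (3 * (8 * t + 1) * n + 13 * t + 1) + 17 by ring,
        cubicDiff_27_mul_add_17, neg_eq_zero, ← ih]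
      congr 2
      ring
  · rw [Int.cast_zero]
    induction j with
    | zero => simpa using cubicDiff_27_mul_add_26 n
    | succ j ih =>
      obtain ⟨t, ht⟩ := exists_nine_pow_eq j
      rw [pow_succ, ht, show (23 * ((8 * t + 1) * 9) + 1) / 8 = 207 * t + 26 by omega] at ih
      rw [pow_succ, pow_succ, ht,
        show (23 * ((8 * t + 1) * 9 * 9) + 1) / 8 = 1863 * t + 233 by omega,
        show 3 * ((8 * t + 1) * 9 * 9) * n + (1863 * t + 233) =
          27 * (9 * (8 * t + 1) * n + 69 * t + 8) + 17 by ring,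
        cubicDiff_27_mul_add_17, neg_eq_zero, ← ih]
      congr 2
      ring
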